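/- **Theorem 1.4.** A *straight-line program* (SLP) is a sequence $(b_0,\dots,b_m)$ of integers with $b_0=1$ together with, for each $1\le i\le m$, an instruction $b_i=b_j\circ_i b_k$, where $0\le j,k<i$ and $\circ_i\in\{+,-,\times\}$; it represents the integer $N=b_m$. An SLP is given as the word over a finite alphabet that lists its instructions $(\circ_i,j,k)$ in order, with the indices $j,k$ written in binary. Consider the two decision problems * $\mathrm{PosSLP}$: given an SLP representing $N\in\mathbb Z$, decide whether $N>0$; * $\mathrm{3SoSSLP}$: given an SLP representing $N\in\mathbb Z$, decide whether $N=x^2+y^2+z^2$ for some $x,y,z\in\mathbb Z$ (words that do not encode an SLP are no-instances of both). Then $$\mathrm{PosSLP}\in\mathrm P^{\mathrm{3SoSSLP}},$$ that is, there are a deterministic oracle Turing machine with oracle $\mathrm{3SoSSLP}$ and a polynomial $p$ such that on every input word $w$ the machine halts within $p(|w|)$ steps (an oracle query counting as one step), and accepts if and only if $w\in\mathrm{PosSLP}$. -/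

import Mathlib

/-! Oracle Turing machines and the class of languages decidable in polynomial time with an oracle. -/

namespace OracleComplexity

/-- A deterministic oracle Turing machine with input alphabet `α` and oracle alphabet `β`.
It is a multi-stack machine (Mathlib's model `Turing.TM2`, two stacks being one tape) with finitely
many stacks, finite stack alphabets, finitely many labels and finitely many internal states.
At every label it either executes an ordinary statement of the `TM2` language, or it queries the
oracle about the word that is currently on the query stack and continues at a label that depends
only on the answer. -/
structure OracleTM (α β : Type) where
  /-- the index type of the stacks -/
  K : Type
  [decEqK : DecidableEq K]
  [finK : Fintype K]
  /-- the alphabet of each stack -/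
  Γ : K → Type
  [finΓ : ∀ k, Fintype (Γ k)]
  /-- the labels of the program -/
  Λ : Type
  [finΛ : Fintype Λ]
  /-- the internal states -/
  σ : Type
  [finσ : Fintype σ]
  /-- the stack that initially holds the input -/
  kIn : K
  /-- the stack from which the oracle reads queries -/
  kQuery : K
  /-- the input stack is over the input alphabet -/
  inAlphabet : Γ kIn ≃ α
  /-- the query stack is over the oracle alphabet -/
  queryAlphabet : Γ kQuery ≃ β
  /-- the label at which the computation starts -/
  start : Λ
  /-- the internal state in which the computation starts -/
  initial : σ
  /-- the program: an ordinary statement, or a query with the labels to go to on each answer -/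
  prog : Λ → Turing.TM2.Stmt Γ Λ σ ⊕ (Bool → Λ)
  /-- the internal states in which a halted computation accepts -/
  accept : σ → Bool

namespace OracleTM

variable {α β : Type} (M : OracleTM α β)

instance : DecidableEq M.K := M.decEqK

/-- A configuration: the current label (`none` if halted), the internal state, and the stacks. -/
abbrev Cfg : Type := Turing.TM2.Cfg M.Γ M.Λ M.σ

/-- The initial configuration on input `w`: the first letter of `w` is on top of the input stack,
and all other stacks are empty. -/
def init (w : List α) : M.Cfg where
  l := some M.start
  var := M.initial
  stk := Function.update (fun _ => []) M.kIn (w.map M.inAlphabet.symm)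

/-- The word on the query stack, read from the top. -/
def queryWord (S : ∀ k, List (M.Γ k)) : List β := (S M.kQuery).map M.queryAlphabet

open Classical in
/-- One step of the computation with oracle `O`; a query costs one step and leaves the stacks and
the internal state unchanged. A halted configuration has no successor. -/
noncomputable def step (O : Language β) : M.Cfg → Option M.Cfg
  | ⟨none, _, _⟩ => none
  | ⟨some l, v, S⟩ =>
    match M.prog l with
    | .inl q => some (Turing.TM2.stepAux q v S)
    | .inr next => some ⟨some (next (decide (M.queryWord S ∈ O))), v, S⟩

/-- With oracle `O` and on input `w`, the machine halts within `n` steps, in an accepting state if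
`w ∈ A` and in a non-accepting state if `w ∉ A`. -/
def DecidesWithin (O : Language β) (A : Language α) (w : List α) (n : ℕ) : Prop :=
  ∃ c : M.Cfg, Nonempty (StateTransition.EvalsToInTime (M.step O) (M.init w) (some c) n) ∧
    c.l = none ∧ (M.accept c.var = true ↔ w ∈ A)

end OracleTM

/-- The class `P^O` (of languages over the alphabet `α`): the languages decided by a deterministic
oracle Turing machine with oracle `O` in a number of steps that is polynomial in the length of the
input. -/
def PRel (α : Type) {β : Type} (O : Language β) : Set (Language α) :=
  {A | ∃ (M : OracleTM α β) (p : Polynomial ℕ), ∀ w : List α,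
    M.DecidesWithin O A w (p.eval w.length)}

end OracleComplexity

/-! Division-free, constant-free and variable-free straight-line programs. -/

namespace StraightLine

/-- The operations `+`, `-`, `×`. -/
inductive Op
  | add
  | sub
  | mul
  deriving DecidableEq

instance : Fintype Op := ⟨{.add, .sub, .mul}, fun o => by cases o <;> decide⟩

/-- The meaning of an operation on integers. -/
def Op.eval : Op → ℤ → ℤ → ℤ
  | .add, x, y => x + y
  | .sub, x, y => x - y
  | .mul, x, y => x * y

/-- An instruction `b_left ∘ b_right`. -/
structure Instr where
  /-- the operation `∘` -/
  op : Op
  /-- the index of the left operand -/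
  left : ℕ
  /-- the index of the right operand -/
  right : ℕ
  deriving DecidableEq

/-- A straight-line program `(b_0, …, b_m)`, with `b_0 = 1`. The entry of `instrs` at position `i`
(counted from `0`) is the instruction for `b_{i+1}`, whose operands have indices less than `i + 1`;
so `m = instrs.length`. -/
structure SLP where
  /-- the instructions for `b_1, …, b_m` -/
  instrs : List Instr
  /-- only earlier entries are used -/
  wf : ∀ (i : ℕ) (h : i < instrs.length), instrs[i].left < i + 1 ∧ instrs[i].right < i + 1

/-- Append the value of the next instruction to the list of the values computed so far. (The
default `0` is never used in the evaluation of an `SLP`.) -/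
def extend (bs : List ℤ) (I : Instr) : List ℤ :=
  bs ++ [I.op.eval (bs.getD I.left 0) (bs.getD I.right 0)]

/-- The list `[b_0, …, b_m]` for a list of `m` instructions. -/
def values (L : List Instr) : List ℤ := L.foldl extend [1]

namespace SLP

/-- The entry `b_i` of the program. -/
def b (P : SLP) (i : ℕ) : ℤ := (values P.instrs).getD i 0

/-- The integer `b_m` computed by the program. -/
def value (P : SLP) : ℤ := P.b P.instrs.length

end SLP

theorem values_append_singleton (L : List Instr) (I : Instr) :
    values (L ++ [I]) = extend (values L) I := by
  simp [values]

theorem length_values (L : List Instr) : (values L).length = L.length + 1 := by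
  induction L using List.reverseRecOn with
  | nil => rfl
  | append_singleton L I ih => rw [values_append_singleton]; simp [extend, ih]

theorem values_append_getD (L L' : List Instr) (i : ℕ) (hi : i ≤ L.length) :
    (values (L ++ L')).getD i 0 = (values L).getD i 0 := by
  induction L' using List.reverseRecOn with
  | nil => simp
  | append_singleton L' I ih =>
    rw [← List.append_assoc, values_append_singleton, extend, List.getD_append, ih]
    rw [length_values, List.length_append]; omega

/-- The sequence starts with `b_0 = 1`. -/
theorem SLP.b_zero (P : SLP) : P.b 0 = 1 := by
  simpa [SLP.b, values] using values_append_getD [] P.instrs 0 le_rfl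

/-- The defining recurrence `b_{i+1} = b_j ∘ b_k`. -/
theorem SLP.b_succ (P : SLP) (i : ℕ) (h : i < P.instrs.length) :
    P.b (i + 1) = P.instrs[i].op.eval (P.b P.instrs[i].left) (P.b P.instrs[i].right) := by
  obtain ⟨hl, hr⟩ := P.wf i h
  have hlen : (P.instrs.take i).length = i := by simp; omega
  have key : ∀ j, j < i + 1 → P.b j = (values (P.instrs.take i)).getD j 0 := fun j hj => by
    rw [← values_append_getD _ (P.instrs.drop i) j (by omega), List.take_append_drop, SLP.b]
  rw [key _ hl, key _ hr]
  have h1 : P.b (i + 1) = (values (P.instrs.take (i + 1))).getD (i + 1) 0 := by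
    rw [← values_append_getD _ (P.instrs.drop (i + 1)) _ (by simp; omega),
      List.take_append_drop, SLP.b]
  rw [h1, List.take_succ_eq_append_getElem h, values_append_singleton, extend,
    List.getD_append_right _ _ _ _ (by rw [length_values]; omega), length_values, hlen]
  simp

/-! Straight-line programs as words over a finite alphabet. -/

/-- The alphabet in which programs are written: operation symbols, binary digits, a comma. -/
inductive Sym
  | op (o : Op)
  | bit (d : Bool)
  | comma
  deriving DecidableEq, Fintype

/-- The instruction `b_j ∘ b_k` is written as `∘ j , k` with `j` and `k` in binary, least
significant digit first and without superfluous digits (`0` is the empty word). -/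
def Instr.encode (I : Instr) : List Sym :=
  Sym.op I.op :: (I.left.bits.map Sym.bit ++ Sym.comma :: I.right.bits.map Sym.bit)

/-- A program is written as the concatenation of its instructions. -/
def SLP.encode (P : SLP) : List Sym := P.instrs.flatMap Instr.encode

/-- An integer is `3SoS` if it is a sum of three squares of integers. -/
def IsThreeSoS (N : ℤ) : Prop := ∃ x y z : ℤ, N = x ^ 2 + y ^ 2 + z ^ 2

/-- `PosSLP`: given a straight-line program representing `N`, decide whether `N > 0`. -/
def PosSLP : Language Sym := {w | ∃ P : SLP, P.encode = w ∧ 0 < P.value}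

/-- `3SoSSLP`: given a straight-line program representing `N`, decide whether `N` is a sum of three
squares. -/
def ThreeSoSSLP : Language Sym := {w | ∃ P : SLP, P.encode = w ∧ IsThreeSoS P.value}

end StraightLine

/-! Sums of three squares. -/

namespace ThreeSquares

/-! One oracle query suffices. If `N ≤ 0`, then `8 N - 5` is negative; if `N > 0`, it is a positive
integer congruent to 3 modulo 8, hence a sum of three squares. So `N > 0` iff `8 N - 5` is a sum of
three squares.

The three-squares theorem is needed only for `n = 8 w + 3`. Dirichlet's theorem and quadratic
reciprocity give a positive definite ternary form of determinant 1 with value `n`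
(`of_mod_eight_eq_three`), and reduction shows that such a form takes only sums of three squares
(`ternary_form_value`).

On words, six instructions are appended. Their indices depend only on the number of operation
symbols in the input. Since an operation symbol can only start an instruction, a word that encodes
no program still encodes none afterwards (`append_tail_mem_threeSoSSLP_iff`). A stack machine with a
binary counter writes the extended word in quadratic time (`init_reaches`). -/

/-- A positive definite binary form `k y² + 2 l y z + m z²` takes at some primitive vector a value
`v` with `3 v² ≤ 4 D`, where `D` is the determinant. -/
theorem exists_primitive_value_le (D : ℤ) (hD : 0 < D) (N : ℕ) :
    ∀ k l m : ℤ, 0 < k → k.toNat ≤ N → k * m - l ^ 2 = D →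
      ∃ p r : ℤ, IsCoprime p r ∧
        3 * (k * p ^ 2 + 2 * l * p * r + m * r ^ 2) ^ 2 ≤ 4 * D := by
  induction N with
  | zero => intro k l m hk hN; omega
  | succ N ih =>
    intro k l m hk hN hdet
    -- Gauss reduction: `t` is the integer nearest to `-l / k`, so that `|l'| ≤ k / 2`. If `m' < k`,
    -- swap the variables and recurse; otherwise `k² ≤ k m' = D + l'² ≤ D + k² / 4`.
    obtain ⟨t, ht⟩ : ∃ t : ℤ, (2 * (l + k * t)) ^ 2 ≤ k ^ 2 := by
      refine ⟨-((2 * l + k) / (2 * k)), ?_⟩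
      have h1 := Int.emod_add_mul_ediv (2 * l + k) (2 * k)
      have h2 := Int.emod_nonneg (2 * l + k) (b := 2 * k) (by omega)
      have h3 := Int.emod_lt_of_pos (2 * l + k) (b := 2 * k) (by omega)
      apply sq_le_sq'
      · linarith
      · linarith
    set l' := l + k * t with hl'
    set m' := m + 2 * l * t + k * t ^ 2 with hm'
    have hdet' : k * m' - l' ^ 2 = D := by rw [← hdet, hl', hm']; ring
    by_cases hlt : m' < k
    · have hm0 : 0 < m' := by
        by_contra h
        have := mul_nonpos_of_nonneg_of_nonpos hk.le (not_lt.1 h)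
        nlinarith [sq_nonneg l']
      obtain ⟨p, r, hpr, h⟩ := ih m' (-l') k hm0 (by omega) (by linarith)
      refine ⟨t * p - r, p, ?_, ?_⟩
      · obtain ⟨u, v, huv⟩ := hpr
        exact ⟨-v, u + v * t, by linear_combination huv⟩
      · convert h using 3
        rw [hl', hm']; ring
    · refine ⟨1, 0, isCoprime_one_left, ?_⟩
      have := mul_le_mul_of_nonneg_left (not_lt.1 hlt) hk.le
      nlinarith

/-- An integral positive definite ternary form
`a x² + 2 b x y + 2 c x z + d y² + 2 e y z + f z²` of determinant one takes only sums of three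
squares as values. -/
theorem ternary_form_value (N : ℕ) :
    ∀ a b c d e f : ℤ, 0 < a → a.toNat ≤ N → 0 < a * d - b ^ 2 →
      a * d * f + 2 * b * c * e - a * e ^ 2 - d * c ^ 2 - f * b ^ 2 = 1 →
      ∀ x y z : ℤ, StraightLine.IsThreeSoS
        (a * x ^ 2 + 2 * b * x * y + 2 * c * x * z + d * y ^ 2 + 2 * e * y * z + f * z ^ 2) := by
  induction N with
  | zero => intro a b c d e f ha hN; omega
  | succ N ih =>
    intro a b c d e f ha hN hK hdet x y z
    -- Completing the square, `a` times the form is `(a x + b y + c z)²` plus a binary form in `y,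
    -- z`, whose determinant is `a`.
    have hKdet : (a * d - b ^ 2) * (a * f - c ^ 2) - (a * e - b * c) ^ 2 = a := by
      linear_combination a * hdet
    obtain ⟨p, r, ⟨s, q, hsq⟩, hle⟩ :=
      exists_primitive_value_le a ha _ (a * d - b ^ 2) (a * e - b * c) (a * f - c ^ 2) hK le_rfl hKdet
    set k := (a * d - b ^ 2) * p ^ 2 + 2 * (a * e - b * c) * p * r + (a * f - c ^ 2) * r ^ 2
      with hk
    have hk0 : 0 < k := by
      have h1 : (a * d - b ^ 2) * k =
          ((a * d - b ^ 2) * p + (a * e - b * c) * r) ^ 2 + a * r ^ 2 := by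
        rw [hk]; linear_combination r ^ 2 * hKdet
      refine pos_of_mul_pos_right (a := a * d - b ^ 2) ?_ hK.le
      rw [h1]
      rcases eq_or_ne r 0 with rfl | hr
      · have hp : p ≠ 0 := by rintro rfl; simp at hsq
        have : 0 < ((a * d - b ^ 2) * p) ^ 2 := by
          have := mul_ne_zero hK.ne' hp
          positivity
        simpa using this
      · positivity
    by_cases ha1 : a = 1
    · subst ha1
      have hk1 : k = 1 := by nlinarith
      -- The binary form has determinant 1 and value 1 at `(p, r)`. The last two squares come from
      -- multiplying it by `k = 1` and completing the square.
      refine ⟨x + b * y + c * z, (1 * d - b ^ 2) * p * y + (1 * e - b * c) * (p * z + r * y)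
        + (1 * f - c ^ 2) * r * z, p * z - r * y, ?_⟩
      linear_combination ((1 * d - b ^ 2) * y ^ 2 + 2 * (1 * e - b * c) * y * z +
        (1 * f - c ^ 2) * z ^ 2) * (hk - hk1) + (p * z - r * y) ^ 2 * hKdet
    · obtain ⟨t, ht⟩ : ∃ t : ℤ, (2 * (b * p + c * r + a * t)) ^ 2 ≤ a ^ 2 := by
        refine ⟨-((2 * (b * p + c * r) + a) / (2 * a)), ?_⟩
        have h1 := Int.emod_add_mul_ediv (2 * (b * p + c * r) + a) (2 * a)
        have h2 := Int.emod_nonneg (2 * (b * p + c * r) + a) (b := 2 * a) (by omega)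
        have h3 := Int.emod_lt_of_pos (2 * (b * p + c * r) + a) (b := 2 * a) (by omega)
        apply sq_le_sq'
        · linarith
        · linarith
      -- The value at `(t, p, r)` is smaller than `a`: otherwise `3 a² ≤ 4 k`, which with `3 k² ≤ 4
      -- a` gives `27 a³ ≤ 64`, impossible for `a ≥ 2`.
      have hlt : d * p ^ 2 + 2 * e * p * r + f * r ^ 2 + 2 * t * (b * p + c * r) + a * t ^ 2 < a := by
        by_contra h
        have h1 := mul_le_mul_of_nonneg_left (not_lt.1 h) ha.le
        have h2 : 3 * a ^ 2 ≤ 4 * k := by rw [hk]; linarith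
        have h3 : (3 * a ^ 2) ^ 2 ≤ (4 * k) ^ 2 := by
          exact pow_le_pow_left₀ (by positivity) h2 2
        have h4 : a * (27 * a ^ 3) ≤ a * 64 := by linarith
        have h5 := le_of_mul_le_mul_left h4 ha
        have h6 : (2 : ℤ) ^ 3 ≤ a ^ 3 := pow_le_pow_left₀ (by norm_num) (by omega) 3
        linarith
      have hpos : 0 < d * p ^ 2 + 2 * e * p * r + f * r ^ 2 + 2 * t * (b * p + c * r) + a * t ^ 2 := by
        refine pos_of_mul_pos_right (a := a) ?_ ha.le
        have : k + (b * p + c * r + a * t) ^ 2 =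
          a * (d * p ^ 2 + 2 * e * p * r + f * r ^ 2 + 2 * t * (b * p + c * r) + a * t ^ 2) := by
          rw [hk]; ring
        rw [← this]; positivity
      -- Pass to the basis `(t, p, r)`, `(1, 0, 0)`, `(0, -q, s)`, unimodular because `s p + q r =
      -- 1`. The new leading coefficient is the smaller value just found.
      obtain ⟨Y, hY⟩ : ∃ Y, Y = s * y + q * z := ⟨_, rfl⟩
      obtain ⟨Z, hZ⟩ : ∃ Z, Z = -r * y + p * z := ⟨_, rfl⟩
      have hy : y = p * Y - q * Z := by rw [hY, hZ]; linear_combination -y * hsq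
      have hz : z = r * Y + s * Z := by rw [hY, hZ]; linear_combination -z * hsq
      have key := ih
        (d * p ^ 2 + 2 * e * p * r + f * r ^ 2 + 2 * t * (b * p + c * r) + a * t ^ 2)
        (b * p + c * r + a * t)
        (-d * p * q + e * (p * s - q * r) + f * r * s + t * (-b * q + c * s))
        a (-b * q + c * s) (d * q ^ 2 - 2 * e * q * s + f * s ^ 2) hpos (by omega)
        (by rw [hk] at hk0; linarith)
        (by linear_combination (s * p + q * r) ^ 2 * hdet + (s * p + q * r + 1) * hsq)
        Y (x - t * Y) Z
      convert key using 1
      rw [hy, hz]; ring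

/-- A natural number congruent to `3` modulo `8` is a sum of three squares. -/
theorem of_mod_eight_eq_three (n : ℕ) (hn : n % 8 = 3) : StraightLine.IsThreeSoS n := by
  obtain ⟨w, rfl⟩ : ∃ w, n = 8 * w + 3 := ⟨n / 8, by omega⟩
  have hcop : (4 * w + 1).Coprime (4 * (8 * w + 3)) := by
    rw [← Nat.isCoprime_iff_coprime]
    exact ⟨1 + 8 * w, -w, by push_cast; ring⟩
  -- This residue class makes `2 p + 1 = (8 w + 3) (8 v + 1)`. Hence `2 p ≡ -1` modulo `8 v + 1`,
  -- and reciprocity makes `-(8 v + 1)` a square modulo `p`.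
  obtain ⟨p, hgt, hp, hmod⟩ :=
    Nat.forall_exists_prime_gt_and_modEq (4 * w + 1) (q := 4 * (8 * w + 3)) (by omega) hcop
  obtain ⟨v, hv⟩ := (Nat.modEq_iff_dvd' hgt.le).1 hmod.symm
  have hp' : p = 4 * (8 * w + 3) * v + (4 * w + 1) := by omega
  have : Fact p.Prime := ⟨hp⟩
  have hp4 : p % 4 = 1 := by rw [hp', mul_assoc]; omega
  have hodd : Odd p := Nat.odd_iff.2 (by omega)
  have hb : Odd (8 * v + 1) := ⟨4 * v, by ring⟩
  have hJ : jacobiSym (-((8 * v + 1 : ℕ) : ℤ)) p = 1 := by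
    rw [jacobiSym.neg _ hodd, ZMod.χ₄_nat_one_mod_four hp4, one_mul,
      jacobiSym.quadratic_reciprocity_one_mod_four' hb hp4]
    have h2 : jacobiSym 2 (8 * v + 1) = 1 := by
      rw [jacobiSym.at_two hb, ZMod.χ₈_nat_eq_if_mod_eight]
      simp [Nat.add_mod, Nat.mul_mod]
    have h3 : jacobiSym (2 * (p : ℤ)) (8 * v + 1) = 1 := by
      rw [jacobiSym.mod_left' (a₂ := -1), jacobiSym.at_neg_one hb, ZMod.χ₄_nat_one_mod_four]
      · omega
      · change _ ≡ _ [ZMOD _]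
        refine Int.ModEq.symm ?_
        rw [Int.modEq_iff_dvd]
        refine ⟨8 * w + 3, ?_⟩
        rw [hp']; push_cast; ring
    rw [jacobiSym.mul_left, h2, one_mul] at h3
    exact h3
  obtain ⟨c₀, hc₀⟩ := ZMod.isSquare_of_jacobiSym_eq_one hJ
  have hdvd : ∀ c : ℤ, (c : ZMod p) = c₀ → (p : ℤ) ∣ (8 * v + 1) + c ^ 2 := by
    intro c hc
    rw [← ZMod.intCast_zmod_eq_zero_iff_dvd]
    push_cast at hc₀ ⊢
    rw [hc]; linear_combination -hc₀
  -- Adding the odd number `p` changes the parity of the root; an odd root gives divisibility by `2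
  -- p`.
  obtain ⟨c, hc2, hcp⟩ : ∃ c : ℤ, c % 2 = 1 ∧ (p : ℤ) ∣ (8 * v + 1) + c ^ 2 := by
    rcases Int.emod_two_eq_zero_or_one (c₀.val : ℤ) with h | h
    · exact ⟨c₀.val + p, by omega, hdvd _ (by simp)⟩
    · exact ⟨c₀.val, h, hdvd _ (by simp)⟩
  obtain ⟨a, ha⟩ : (2 * p : ℤ) ∣ (8 * v + 1) + c ^ 2 := by
    refine IsCoprime.mul_dvd ?_ ?_ hcp
    · exact_mod_cast Nat.isCoprime_iff_coprime.2 (Nat.coprime_two_left.2 hodd)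
    · obtain ⟨t, rfl⟩ : ∃ t, c = 2 * t + 1 := ⟨c / 2, by omega⟩
      exact ⟨4 * v + 2 * t ^ 2 + 2 * t + 1, by ring⟩
  have ha0 : 0 < a := by
    refine pos_of_mul_pos_right (a := 2 * (p : ℤ)) ?_ (by positivity)
    rw [← ha]; positivity
  have hpz : (p : ℤ) = 4 * (8 * w + 3) * v + (4 * w + 1) := by exact_mod_cast hp'
  -- The determinant is `(8 w + 3) (2 p a - c²) - 2 p = (8 w + 3) (8 v + 1) - 2 p = 1`, and the
  -- value at `(0, 0, 1)` is `8 w + 3`.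
  have key := ternary_form_value _ a c 1 (2 * p) 0 (8 * w + 3) ha0 le_rfl
    (by rw [show a * (2 * (p : ℤ)) - c ^ 2 = 8 * v + 1 by linarith]; positivity)
    (by linear_combination -(8 * w + 3 : ℤ) * ha - 2 * hpz) 0 0 1
  convert key using 1
  push_cast; ring

end ThreeSquares

/-! Appending to the word of a straight-line program for `N` instructions that compute `8 N - 5`. -/

namespace StraightLine

/-- Whether a symbol is an operation symbol. -/
def Sym.isOp : Sym → Bool
  | .op _ => true
  | _ => false

/-! ### Unique decoding of instruction words. -/

theorem bits_injective : Function.Injective Nat.bits := fun m n h => by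
  rw [← Nat.digits_inj_iff (b := 2), Nat.digits_two_eq_bits, Nat.digits_two_eq_bits, h]

theorem map_bit_append_inj : ∀ (a a' : List Bool) (c c' : List Sym),
    (∀ d t, c ≠ Sym.bit d :: t) → (∀ d t, c' ≠ Sym.bit d :: t) →
    a.map Sym.bit ++ c = a'.map Sym.bit ++ c' → a = a' ∧ c = c'
  | [], [], _, _, _, _, h => by simpa using h
  | [], d :: a', c, c', hc, _, h => (hc d _ h).elim
  | d :: a, [], c, c', _, hc', h => (hc' d _ h.symm).elim
  | d :: a, d' :: a', c, c', hc, hc', h => by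
    simp only [List.map_cons, List.cons_append, List.cons.injEq, Sym.bit.injEq] at h
    obtain ⟨h1, h2⟩ := map_bit_append_inj a a' c c' hc hc' h.2
    exact ⟨by rw [h.1, h1], h2⟩

theorem flatMap_encode_ne_bit (L : List Instr) (d : Bool) (t : List Sym) :
    L.flatMap Instr.encode ≠ Sym.bit d :: t := by
  cases L <;> simp [Instr.encode]

/-- The right index has no end marker, but its digits stop at the next operation symbol or at the
end of the word. -/
theorem flatMap_encode_injective :
    Function.Injective fun L : List Instr => L.flatMap Instr.encode := by
  intro L L' h
  induction L generalizing L' with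
  | nil => cases L' <;> simp_all [Instr.encode]
  | cons I L ih =>
    cases L' with
    | nil => simp [Instr.encode] at h
    | cons I' L' =>
      simp only [List.flatMap_cons, Instr.encode, List.cons_append, List.append_assoc,
        List.cons.injEq, Sym.op.injEq] at h
      obtain ⟨hl, h2⟩ := map_bit_append_inj _ _ _ _ (by simp) (by simp) h.2
      obtain ⟨hr, h3⟩ := map_bit_append_inj _ _ _ _ (flatMap_encode_ne_bit L)
        (flatMap_encode_ne_bit L') (List.cons.inj h2).2
      rw [ih h3]
      congr 1
      cases I; cases I'
      simp_all [bits_injective.eq_iff]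

/-- An operation symbol in the word of a list of instructions is the beginning of an instruction. -/
theorem flatMap_encode_eq_append {L : List Instr} {w s : List Sym} {o : Op}
    (h : L.flatMap Instr.encode = w ++ Sym.op o :: s) :
    ∃ L₁ L₂, L = L₁ ++ L₂ ∧ w = L₁.flatMap Instr.encode ∧
      Sym.op o :: s = L₂.flatMap Instr.encode := by
  induction L generalizing w with
  | nil => simp at h
  | cons I L ih =>
    rcases w with - | ⟨x, w⟩
    · exact ⟨[], I :: L, rfl, rfl, h.symm⟩
    · rw [List.flatMap_cons, List.append_eq_append_iff] at h
      rcases h with ⟨w', hw, h⟩ | ⟨c, hI, h⟩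
      · obtain ⟨L₁, L₂, rfl, rfl, hs⟩ := ih h
        exact ⟨I :: L₁, L₂, rfl, by rw [hw, List.flatMap_cons], hs⟩
      · rcases c with - | ⟨y, c⟩
        · obtain ⟨L₁, L₂, rfl, hw, hs⟩ := ih (w := []) h.symm
          exact ⟨I :: L₁, L₂, rfl, by rw [List.flatMap_cons, ← hw, hI, List.append_nil,
            List.append_nil], hs⟩
        · obtain ⟨rfl, -⟩ := List.cons.inj h
          simp only [Instr.encode, List.cons_append, List.cons.injEq] at hI
          -- A cut strictly inside an instruction would put an operation symbol among its digits and
          -- comma.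
          have : Sym.op o ∈ w ++ Sym.op o :: c := by simp
          rw [← hI.2] at this
          simp at this

/-- This lets the machine find the index of the last entry without parsing its input. -/
theorem countP_isOp_flatMap_encode (L : List Instr) :
    (L.flatMap Instr.encode).countP Sym.isOp = L.length := by
  have h : ∀ l : List Bool, (l.map Sym.bit).countP Sym.isOp = 0 := fun l => by
    simp [List.countP_eq_zero, Sym.isOp]
  induction L with
  | nil => rfl
  | cons I L ih =>
    simp [List.countP_append, List.countP_cons, Instr.encode, h, ih, Sym.isOp, add_comm]

/-- Instructions that compute `8 N - 5` from `b_m = N`. -/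
def tail (m : ℕ) : List Instr :=
  [⟨.add, m, m⟩, ⟨.sub, m + 1, 0⟩, ⟨.add, m + 2, m + 2⟩, ⟨.sub, m + 3, 0⟩, ⟨.add, m + 4, m + 4⟩,
    ⟨.add, m + 5, 0⟩]

theorem value_append_tail (P Q : SLP) (h : Q.instrs = P.instrs ++ tail P.instrs.length) :
    Q.value = 8 * P.value - 5 := by
  obtain ⟨m, hm⟩ : ∃ m, P.instrs.length = m := ⟨_, rfl⟩
  have hlen : Q.instrs.length = m + 6 := by rw [h, hm]; simp [tail, hm]
  have hP : Q.b m = P.value := by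
    rw [SLP.b, h, values_append_getD _ _ _ hm.ge, SLP.value, SLP.b, hm]
  have hb : ∀ j (hj : j < 6), Q.b (m + j + 1) = ((tail m)[j]'(by simpa [tail] using hj)).op.eval
      (Q.b ((tail m)[j]'(by simpa [tail] using hj)).left)
      (Q.b ((tail m)[j]'(by simpa [tail] using hj)).right) := by
    intro j hj
    have : Q.instrs[m + j]'(by omega) = (tail m)[j]'(by simpa [tail] using hj) := by
      simp only [h, hm]
      rw [List.getElem_append_right (by omega)]
      simp [hm]
    rw [Q.b_succ _ (by omega), this]
  -- The successive values are `2 N`, `2 N - 1`, `4 N - 2`, `4 N - 3`, `8 N - 6`, `8 N - 5`.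
  have h0 := hb 0 (by norm_num)
  have h1 := hb 1 (by norm_num)
  have h2 := hb 2 (by norm_num)
  have h3 := hb 3 (by norm_num)
  have h4 := hb 4 (by norm_num)
  have h5 := hb 5 (by norm_num)
  simp only [tail, List.getElem_cons_zero, List.getElem_cons_succ, Op.eval, SLP.b_zero, add_zero,
    add_assoc, Nat.reduceAdd] at h0 h1 h2 h3 h4 h5
  rw [SLP.value, hlen, h5, h4, h3, h2, h1, h0, hP]
  ring

/-- The reduction of `PosSLP` to `ThreeSoSSLP`. -/
theorem append_tail_mem_threeSoSSLP_iff (w : List Sym) :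
    w ++ (tail (w.countP Sym.isOp)).flatMap Instr.encode ∈ ThreeSoSSLP ↔ w ∈ PosSLP := by
  have hpos : ∀ N : ℤ, IsThreeSoS (8 * N - 5) ↔ 0 < N := by
    intro N
    constructor
    · rintro ⟨x, y, z, h⟩
      have : 0 ≤ x ^ 2 + y ^ 2 + z ^ 2 := by positivity
      omega
    · intro hN
      have := ThreeSquares.of_mod_eight_eq_three (8 * N - 5).toNat (by omega)
      rwa [Int.toNat_of_nonneg (by omega)] at this
  constructor
  · rintro ⟨Q, hQ, hN⟩
    -- The appended word starts with an operation symbol, so `w` is cut off at an instruction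
    -- boundary; a prefix of a program is again a program.
    obtain ⟨L₁, L₂, hL, hw, hs⟩ := flatMap_encode_eq_append
      (L := Q.instrs) (w := w) (o := .add) (by rw [← SLP.encode, hQ]; rfl)
    have hcount : w.countP Sym.isOp = L₁.length := by rw [hw, countP_isOp_flatMap_encode]
    have hL₂ : tail L₁.length = L₂ := by
      apply flatMap_encode_injective
      rw [← hcount]
      exact hs
    let P : SLP := ⟨L₁, fun i hi => by
      have := Q.wf i (by rw [hL, List.length_append]; omega)
      simpa only [hL, List.getElem_append_left hi] using this⟩
    refine ⟨P, hw.symm, ?_⟩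
    rwa [value_append_tail P Q (by rw [hL, hL₂]), hpos] at hN
  · rintro ⟨P, rfl, hN⟩
    rw [SLP.encode, countP_isOp_flatMap_encode]
    let Q : SLP := ⟨P.instrs ++ tail P.instrs.length, fun i hi => by
      by_cases h : i < P.instrs.length
      · simpa only [List.getElem_append_left h] using P.wf i h
      · obtain ⟨j, rfl⟩ := Nat.exists_eq_add_of_le (not_lt.1 h)
        have hj : j < 6 := by simpa [tail] using hi
        rw [List.getElem_append_right (by omega)]
        simp only [Nat.add_sub_cancel_left]
        interval_cases j <;> simp [tail]⟩
    refine ⟨Q, by simp [Q, SLP.encode], ?_⟩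
    rw [value_append_tail P Q rfl]
    exact (hpos _).2 hN

end StraightLine

/-! An oracle machine that appends the word of `tail m` to its input, where `m` is the number of
operation symbols in the input, and accepts if and only if the oracle contains the result. -/

namespace StraightLine

namespace TailMachine

open OracleComplexity Turing.TM2 StateTransition

/-- The stacks: the input, the reversed output, the query, a binary counter with the least
significant digit on top, and an auxiliary stack. -/
inductive Stack
  | inp
  | rev
  | qry
  | ctr
  | aux
  deriving DecidableEq

instance : Fintype Stack :=
  ⟨{.inp, .rev, .qry, .ctr, .aux}, fun k => by cases k <;> decide⟩

/-- The labels. -/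
inductive Label
  | read
  | inc
  | restore
  | copy
  | move
  | ask
  | yes
  | no
  deriving DecidableEq

instance : Fintype Label :=
  ⟨{.read, .inc, .restore, .copy, .move, .ask, .yes, .no}, fun l => by cases l <;> decide⟩

/-- The internal states: whether the input has been consumed and the template is being read, and
the last symbol that was popped. -/
abbrev State : Type := Bool × Option Sym

/-- The statements of the machine. -/
abbrev Stm : Type := Stmt (fun _ : Stack => Sym) Label State

/-- A form of `tail m`, in which `bit true` stands for the word of the current counter and
`bit false` for an increment of the counter. -/
def template : List Sym :=
  [.op .add, .bit true, .comma, .bit true, .bit false, .op .sub, .bit true, .comma, .bit false,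
    .op .add, .bit true, .comma, .bit true, .bit false, .op .sub, .bit true, .comma, .bit false,
    .op .add, .bit true, .comma, .bit true, .bit false, .op .add, .bit true, .comma]

/-- Put a word on a stack, its first letter on top. -/
def pushWord (k : Stack) : List Sym → Stm → Stm
  | [], q => q
  | s :: l, q => pushWord k l (.push k (fun _ => s) q)

/-- Pop a stack into the internal state. -/
def popTo (k : Stack) (q : Stm) : Stm := .pop k (fun v s => (v.1, s)) q

/-- Push the last symbol that was popped. -/
def pushLast (k : Stack) (q : Stm) : Stm := .push k (fun v => v.2.getD .comma) q

/-- Return to the main loop. -/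
def toRead : Stm := .load (fun v => (v.1, none)) (.goto fun _ => .read)

/-- The program of the machine. In the first mode, symbols of the input are copied, and operation
symbols are counted; in the second mode, the template is expanded. -/
def prog : Label → Stm ⊕ (Bool → Label)
  | .read => .inl <| popTo .inp <|
      .branch (fun v => v.2.isNone)
        (.branch (fun v => v.1) (.goto fun _ => .move)
          -- The template goes onto the emptied input stack, so the same loop expands it.
          (.load (fun _ => (true, none)) (pushWord .inp template toRead))) <|
      .branch (fun v => v.1 && v.2 == some (.bit true)) (.goto fun _ => .copy) <|
      .branch (fun v => v.1 && v.2 == some (.bit false)) (.goto fun _ => .inc) <|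
      pushLast .rev <|
      .branch (fun v => !v.1 && v.2.any Sym.isOp) (.goto fun _ => .inc) toRead
  | .inc => .inl <| popTo .ctr <|
      .branch (fun v => v.2 == some (.bit true))
        (.push .aux (fun _ => .bit false) (.goto fun _ => .inc))
        (.push .ctr (fun _ => .bit true) (.goto fun _ => .restore))
  | .restore => .inl <| popTo .aux <|
      .branch (fun v => v.2.isSome) (pushLast .ctr (.goto fun _ => .restore)) toRead
  | .copy => .inl <| popTo .ctr <|
      .branch (fun v => v.2.isSome) (pushLast .rev (pushLast .aux (.goto fun _ => .copy)))
        (.goto fun _ => .restore)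
  | .move => .inl <| popTo .rev <|
      .branch (fun v => v.2.isSome) (pushLast .qry (.goto fun _ => .move)) (.goto fun _ => .ask)
  | .ask => .inr fun b => if b then .yes else .no
  | .yes => .inl <| .load (fun _ => (true, none)) .halt
  | .no => .inl <| .load (fun _ => (false, none)) .halt

end TailMachine

open TailMachine in
/-- The machine. -/
def tailMachine : OracleComplexity.OracleTM Sym Sym where
  K := Stack
  Γ := fun _ => Sym
  Λ := Label
  σ := State
  kIn := .inp
  kQuery := .qry
  inAlphabet := Equiv.refl _
  queryAlphabet := Equiv.refl _
  start := .read
  initial := (false, none)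
  prog := prog
  accept := fun v => v.1

/-! ### Step-counted runs of the machine. -/

namespace TailMachine

open OracleComplexity Turing.TM2 StateTransition

/-- The contents of the stacks. -/
def stk (i r q c a : List Sym) : Stack → List Sym
  | .inp => i
  | .rev => r
  | .qry => q
  | .ctr => c
  | .aux => a

section stk

variable (i r q c a x : List Sym)

theorem update_inp : Function.update (stk i r q c a) .inp x = stk x r q c a := by
  funext k; cases k <;> rfl

theorem update_rev : Function.update (stk i r q c a) .rev x = stk i x q c a := by
  funext k; cases k <;> rfl

theorem update_qry : Function.update (stk i r q c a) .qry x = stk i r x c a := by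
  funext k; cases k <;> rfl

theorem update_ctr : Function.update (stk i r q c a) .ctr x = stk i r q x a := by
  funext k; cases k <;> rfl

theorem update_aux : Function.update (stk i r q c a) .aux x = stk i r q c x := by
  funext k; cases k <;> rfl

end stk

theorem stepAux_pushWord (k : Stack) (l : List Sym) (q : Stm) (v : State)
    (S : Stack → List Sym) :
    stepAux (pushWord k l q) v S = stepAux q v (Function.update S k (l ++ S k)) := by
  induction l generalizing q with
  | nil => simp [pushWord]
  | cons s l ih => simp [pushWord, ih]

/-- A configuration of the machine. -/
def cfg (l : Option Label) (v : State) (i r q c a : List Sym) : tailMachine.Cfg :=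
  ⟨l, v, stk i r q c a⟩

variable (O : Language Sym)

/-- The machine gets from one configuration to another within `n` steps. -/
def ReachesIn (n : ℕ) (c c' : tailMachine.Cfg) : Prop :=
  Nonempty (EvalsToInTime (tailMachine.step O) c (some c') n)

variable {O}

theorem ReachesIn.refl (c : tailMachine.Cfg) : ReachesIn O 0 c c := ⟨EvalsToInTime.refl _ _⟩

theorem ReachesIn.trans {m n : ℕ} {c c' c'' : tailMachine.Cfg} (h : ReachesIn O m c c')
    (h' : ReachesIn O n c' c'') : ReachesIn O (m + n) c c'' := by
  rw [add_comm]
  exact ⟨EvalsToInTime.trans _ _ _ _ _ _ h.some h'.some⟩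

theorem ReachesIn.mono {m n : ℕ} {c c' : tailMachine.Cfg} (h : ReachesIn O m c c')
    (hmn : m ≤ n) : ReachesIn O n c c' :=
  ⟨⟨h.some.toEvalsTo, h.some.steps_le_m.trans hmn⟩⟩

theorem ReachesIn.single {c c' : tailMachine.Cfg} (h : tailMachine.step O c = some c') :
    ReachesIn O 1 c c' :=
  ⟨⟨⟨1, h⟩, le_rfl⟩⟩

theorem ReachesIn.head {n : ℕ} {c c' c'' : tailMachine.Cfg} (h : tailMachine.step O c = some c')
    (h' : ReachesIn O n c' c'') : ReachesIn O (n + 1) c c'' := by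
  rw [add_comm]
  exact (ReachesIn.single h).trans h'

theorem step_inl {l : Label} {s : Stm} (h : prog l = .inl s) (v : State) (i r q c a : List Sym) :
    tailMachine.step O (cfg (some l) v i r q c a) = some (stepAux s v (stk i r q c a)) := by
  simp only [cfg, OracleTM.step, tailMachine, h]
  rfl

theorem restore_reaches (b : Bool) (x : Option Sym) (i r q c a : List Sym) :
    ReachesIn O (a.length + 1) (cfg (some .restore) (b, x) i r q c a)
      (cfg (some .read) (b, none) i r q (a.reverse ++ c) []) := by
  induction a generalizing c x with
  | nil =>
    refine .single ?_
    rw [step_inl rfl]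
    simp [popTo, toRead, pushLast, stk, update_aux, cfg]; rfl
  | cons s a ih =>
    refine .head (c' := cfg (some .restore) (b, some s) i r q (s :: c) a) ?_ ?_
    · rw [step_inl rfl]
      simp [popTo, toRead, pushLast, stk, update_aux, update_ctr, cfg]; rfl
    · simpa using ih (some s) (s :: c)

theorem bits_succ_of_bit_true (n : ℕ) :
    (2 * n + 1 + 1).bits = false :: (n + 1).bits := by
  rw [show 2 * n + 1 + 1 = 2 * (n + 1) by ring, Nat.bit0_bits _ (by omega)]

/-- A digit 1 becomes 0 and carries, so `2 n + 1` reduces to `n`; `a` collects the zeros to be put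
back. -/
theorem inc_reaches (b : Bool) (i r q : List Sym) (m : ℕ) (x : Option Sym) (a : List Sym) :
    ReachesIn O (2 * m.bits.length + a.length + 2)
      (cfg (some .inc) (b, x) i r q (m.bits.map Sym.bit) a)
      (cfg (some .read) (b, none) i r q (a.reverse ++ (m + 1).bits.map Sym.bit) []) := by
  induction m using Nat.strong_induction_on generalizing x a with
  | _ m ih =>
    obtain ⟨n, hn⟩ := Nat.even_or_odd' m
    rcases hn with rfl | rfl
    · rw [Nat.bit1_bits]
      -- Zero is the empty word, so here no digit is popped.
      rcases Nat.eq_zero_or_pos n with rfl | hn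
      · refine .mono (.head (c' := cfg (some .restore) (b, none) i r q [.bit true] a) ?_
          (restore_reaches b none i r q [.bit true] a)) (by simp)
        rw [step_inl rfl]
        simp [popTo, stk, update_ctr, cfg]; rfl
      · rw [Nat.bit0_bits n (by omega)]
        refine .mono (.head (c' := cfg (some .restore) (b, some (.bit false)) i r q
          (.bit true :: n.bits.map Sym.bit) a) ?_
          (restore_reaches b _ i r q (.bit true :: n.bits.map Sym.bit) a)) (by simp)
        rw [step_inl rfl]
        simp [popTo, stk, update_ctr, cfg]; rfl
    · rw [Nat.bit1_bits, bits_succ_of_bit_true]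
      have h := ih n (by omega) (some (.bit true)) (.bit false :: a)
      simp only [List.reverse_cons, List.append_assoc, List.cons_append, List.nil_append] at h
      refine .mono (.head (c' := cfg (some .inc) (b, some (.bit true)) i r q
        (n.bits.map Sym.bit) (.bit false :: a)) ?_ h) (by simp; omega)
      rw [step_inl rfl]
      simp [popTo, stk, update_ctr, update_aux, cfg]; rfl

/-- Both targets receive the digits reversed: the output is kept reversed anyway, and the auxiliary
stack is poured back to restore the counter. -/
theorem copy_reaches (b : Bool) (i q : List Sym) (x : Option Sym) (r c a : List Sym) :
    ReachesIn O (2 * c.length + a.length + 2) (cfg (some .copy) (b, x) i r q c a)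
      (cfg (some .read) (b, none) i (c.reverse ++ r) q (a.reverse ++ c) []) := by
  induction c generalizing x r a with
  | nil =>
    refine .mono (.head (c' := cfg (some .restore) (b, none) i r q [] a) ?_
      (restore_reaches b none i r q [] a)) (by simp)
    rw [step_inl rfl]
    simp [popTo, stk, update_ctr, cfg]; rfl
  | cons s c ih =>
    have h := ih (some s) (s :: r) (s :: a)
    simp only [List.reverse_cons, List.append_assoc, List.cons_append, List.nil_append] at h
    simp only [List.reverse_cons, List.append_assoc, List.cons_append, List.nil_append]
    refine .mono (.head (c' := cfg (some .copy) (b, some s) i (s :: r) q c (s :: a)) ?_ h)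
      (by simp; omega)
    rw [step_inl rfl]
    simp [popTo, pushLast, stk, update_ctr, update_rev, update_aux, cfg]; rfl

theorem move_reaches (b : Bool) (i c a : List Sym) (x : Option Sym) (r q : List Sym) :
    ReachesIn O (r.length + 1) (cfg (some .move) (b, x) i r q c a)
      (cfg (some .ask) (b, none) i [] (r.reverse ++ q) c a) := by
  induction r generalizing x q with
  | nil =>
    refine .single ?_
    rw [step_inl rfl]
    simp [popTo, stk, update_rev, cfg]; rfl
  | cons s r ih =>
    refine .head (c' := cfg (some .move) (b, some s) i r (s :: q) c a) ?_ ?_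
    · rw [step_inl rfl]
      simp [popTo, pushLast, stk, update_rev, update_qry, cfg]; rfl
    · simpa using ih (some s) (s :: q)

/-! ### Reading as a fold, and the total running time. -/

/-- The effect of reading a symbol on the output and the counter. -/
def act : Bool → List Sym × ℕ → Sym → List Sym × ℕ
  | false, (r, m), .op o => (.op o :: r, m + 1)
  | true, (r, m), .bit true => ((m.bits.map Sym.bit).reverse ++ r, m)
  | true, (r, m), .bit false => (r, m + 1)
  | _, (r, m), s => (s :: r, m)

theorem act_counter_le (b : Bool) (p : List Sym × ℕ) (s : Sym) : (act b p s).2 ≤ p.2 + 1 := by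
  obtain ⟨r, m⟩ := p
  rcases b with - | - <;> rcases s with o | (- | -) | - <;> simp [act]

theorem length_bits_le (m : ℕ) : m.bits.length ≤ m := by
  rw [Nat.size_eq_bits_len]
  exact Nat.size_le.2 Nat.lt_two_pow_self

theorem read_reaches (b : Bool) (s : Sym) (i r : List Sym) (m : ℕ) :
    ReachesIn O (2 * m + 3)
      (cfg (some .read) (b, none) (s :: i) r [] (m.bits.map Sym.bit) [])
      (cfg (some .read) (b, none) i (act b (r, m) s).1 []
        ((act b (r, m) s).2.bits.map Sym.bit) []) := by
  have hm := length_bits_le m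
  have plain : ∀ r' : List Sym, tailMachine.step O
      (cfg (some .read) (b, none) (s :: i) r [] (m.bits.map Sym.bit) []) =
      some (cfg (some .read) (b, none) i r' [] (m.bits.map Sym.bit) []) →
      ReachesIn O (2 * m + 3)
      (cfg (some .read) (b, none) (s :: i) r [] (m.bits.map Sym.bit) [])
      (cfg (some .read) (b, none) i r' [] (m.bits.map Sym.bit) []) :=
    fun r' h => (ReachesIn.single h).mono (by omega)
  have incr : ∀ r' : List Sym, tailMachine.step O
      (cfg (some .read) (b, none) (s :: i) r [] (m.bits.map Sym.bit) []) =
      some (cfg (some .inc) (b, some s) i r' [] (m.bits.map Sym.bit) []) →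
      ReachesIn O (2 * m + 3)
      (cfg (some .read) (b, none) (s :: i) r [] (m.bits.map Sym.bit) [])
      (cfg (some .read) (b, none) i r' [] ((m + 1).bits.map Sym.bit) []) :=
    fun r' h => (ReachesIn.head h (inc_reaches b i r' [] m (some s) [])).mono (by simp; omega)
  rcases b with - | - <;> rcases s with o | (- | -) | -
  case true.bit.true =>
    have h := copy_reaches (O := O) true i [] (some (.bit true)) r (m.bits.map Sym.bit) []
    refine (ReachesIn.head (c' := cfg _ _ _ _ _ _ _) ?_ h).mono (by simp; omega)
    rw [step_inl rfl]
    simp [popTo, stk, update_inp, cfg]; rfl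
  all_goals
    first | apply incr | apply plain
    rw [step_inl rfl]
    simp [popTo, pushLast, toRead, stk, update_inp, update_rev, cfg, Sym.isOp]; rfl

theorem read_foldl_reaches (b : Bool) (i l r : List Sym) (m : ℕ) :
    ReachesIn O (l.length * (2 * (m + l.length) + 3))
      (cfg (some .read) (b, none) (l ++ i) r [] (m.bits.map Sym.bit) [])
      (cfg (some .read) (b, none) i (l.foldl (act b) (r, m)).1 []
        ((l.foldl (act b) (r, m)).2.bits.map Sym.bit) []) := by
  induction l generalizing r m with
  | nil => simpa using ReachesIn.refl _
  | cons s l ih =>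
    refine ((read_reaches b s (l ++ i) r m).trans (ih _ _)).mono ?_
    have h := act_counter_le b (r, m) s
    simp only [List.length_cons]
    calc _ ≤ 2 * (m + (l.length + 1)) + 3 + l.length * (2 * (m + (l.length + 1)) + 3) := by
          simp only at h
          exact Nat.add_le_add (by omega) (Nat.mul_le_mul_left _ (by omega))
      _ = _ := by ring

theorem foldl_act_false (w r : List Sym) (m : ℕ) :
    w.foldl (act false) (r, m) = (w.reverse ++ r, m + w.countP Sym.isOp) := by
  induction w generalizing r m with
  | nil => rfl
  | cons s w ih =>
    rcases s with o | d | - <;> simp [act, ih, Sym.isOp, List.countP_cons]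
    omega

/-- Each instruction but the last is followed by an increment; the operand `0` is the empty word, so
nothing is written for it. -/
theorem foldl_act_true_template (r : List Sym) (m : ℕ) :
    (template.foldl (act true) (r, m)).1 =
      ((tail m).flatMap Instr.encode).reverse ++ r := by
  simp [template, act, tail, Instr.encode]

theorem length_flatMap_encode_tail_le (m : ℕ) :
    ((tail m).flatMap Instr.encode).length ≤ 9 * m + 60 := by
  have h0 := length_bits_le m
  have h1 := length_bits_le (m + 1)
  have h2 := length_bits_le (m + 2)
  have h3 := length_bits_le (m + 3)
  have h4 := length_bits_le (m + 4)
  have h5 := length_bits_le (m + 5)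
  simp [tail, Instr.encode]
  omega

theorem init_eq (w : List Sym) :
    tailMachine.init w = cfg (some .read) (false, none) w [] [] [] [] := by
  simp only [OracleTM.init, tailMachine, cfg]
  congr 1
  funext k
  cases k <;> first | exact List.map_id w | rfl

theorem template_reaches (r c : List Sym) :
    ReachesIn O 1 (cfg (some .read) (false, none) [] r [] c [])
      (cfg (some .read) (true, none) template r [] c []) := by
  refine .single ?_
  rw [step_inl rfl]
  simp [popTo, toRead, stk, update_inp, cfg, stepAux_pushWord]; rfl

theorem template_end_reaches (r c : List Sym) :
    ReachesIn O 1 (cfg (some .read) (true, none) [] r [] c [])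
      (cfg (some .move) (true, none) [] r [] c []) := by
  refine .single ?_
  rw [step_inl rfl]
  simp [popTo, stk, update_inp, cfg]; rfl

open Classical in
theorem ask_reaches (x : State) (i r q c a : List Sym) :
    ReachesIn O 2 (cfg (some .ask) x i r q c a)
      (cfg none (decide (q ∈ O), none) i r q c a) := by
  refine .head (c' := cfg (some (if q ∈ O then .yes else .no)) x i r q c a) ?_ (.single ?_)
  · have : tailMachine.queryWord (stk i r q c a) = q := List.map_id q
    simp only [cfg, OracleTM.step, this]
    simp [tailMachine, prog]
  · by_cases h : q ∈ O
    · simp only [h, if_true, decide_true]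
      rw [step_inl rfl]
      simp [cfg]; rfl
    · simp only [h, if_false, decide_false]
      rw [step_inl rfl]
      simp [cfg]; rfl

open Classical in
theorem init_reaches (w : List Sym) :
    ∃ c : List Sym, ReachesIn O (2 * w.length ^ 2 + 100 * w.length + 2000) (tailMachine.init w)
      (cfg none (decide (w ++ (tail (w.countP Sym.isOp)).flatMap Instr.encode ∈ O), none) [] []
        (w ++ (tail (w.countP Sym.isOp)).flatMap Instr.encode) c []) := by
  set m := w.countP Sym.isOp with hm
  have hmw : m ≤ w.length := List.countP_le_length
  have h1 := read_foldl_reaches (O := O) false [] w [] 0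
  rw [foldl_act_false, List.append_nil, List.append_nil, zero_add, zero_add, Nat.zero_bits,
    List.map_nil, ← init_eq, ← hm] at h1
  have h2 := template_reaches (O := O) w.reverse (m.bits.map Sym.bit)
  have h3 := read_foldl_reaches (O := O) true [] template w.reverse m
  rw [foldl_act_true_template, List.append_nil] at h3
  set c := (template.foldl (act true) (w.reverse, m)).2.bits.map Sym.bit
  have h4 := template_end_reaches (O := O)
    (((tail m).flatMap Instr.encode).reverse ++ w.reverse) c
  have h5 := move_reaches (O := O) true [] c [] none
    (((tail m).flatMap Instr.encode).reverse ++ w.reverse) []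
  rw [List.append_nil, ← List.reverse_append, List.reverse_reverse] at h5
  have h6 := ask_reaches (O := O) (true, none) [] []
    (w ++ (tail m).flatMap Instr.encode) c []
  rw [← List.reverse_append] at h3 h4
  refine ⟨c, ((((((h1.trans h2).trans h3).trans h4).trans h5).trans h6)).mono ?_⟩
  -- Only the pass over the input is quadratic; with `m ≤ |w|` the other phases are linear.
  have h7 := length_flatMap_encode_tail_le m
  have h8 : template.length = 26 := rfl
  rw [h8, List.length_reverse, List.length_append]
  ring_nf
  ring_nf at h7
  omega

end TailMachine

end StraightLine

theorem theorem1p4 :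
    StraightLine.PosSLP ∈ OracleComplexity.PRel StraightLine.Sym StraightLine.ThreeSoSSLP := by
  refine ⟨StraightLine.tailMachine, 2 * Polynomial.X ^ 2 + 100 * Polynomial.X + 2000, fun w => ?_⟩
  obtain ⟨c, h⟩ := StraightLine.TailMachine.init_reaches (O := StraightLine.ThreeSoSSLP) w
  refine ⟨_, by simpa [StraightLine.TailMachine.ReachesIn] using h, rfl, ?_⟩
  rw [← StraightLine.append_tail_mem_threeSoSSLP_iff]
  simp [StraightLine.TailMachine.cfg, StraightLine.tailMachine]
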